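/- **Theorem 4.3** (Knuth commutativity of row internal insertion operators). Let $T$ be a semistandard skew tableau of shape $\lambda/\mu$ (positive integer entries, weakly increasing along rows from left to right, strictly increasing down columns), with inner border $\mu$. For a row $i$ such that adding a cell at the end of row $i$ of $\mu$ gives again a partition, the row internal insertion operator $\phi_i$ is defined on $T$: the cell $(i,\mu_i+1)$ becomes a blank cell of the inner shape, and if it carried an entry, that entry is bumped and inserted by ordinary row insertion into row $i+1$, each bumped entry being inserted into the next row, until an entry settles at the end of a row. For a word $u=u_m\cdots u_2u_1$ put $\phi_u=\phi_{u_m}\cdots\phi_{u_2}\phi_{u_1}$ ($\phi_{u_1}$ acting first; $\phi_\emptyset=\mathrm{id}$). The standard order of the boxes of a semistandard skew tableau $U$ is by increasing entry, equal entries being ordered from left to right. The companion word of $U$ is $R(U)=u_{|U|}\cdots u_2u_1$, where $u_p$ is the row index of the $p$-th box of $U$ in the standard order. An internal insertion order word of $T$ is the companion word of any semistandard skew tableau $U$ with the same inner border $\mu$ as $T$. Knuth equivalence $\equiv$ of words is generated by $xzy\equiv zxy$ for $x\le y<z$ and $yzx\equiv yxz$ for $x<y\le z$, inside words. Let $u$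 be an internal insertion order word of $T$ and let $v\equiv u$. Then (a) $v$ is an internal insertion order word of $T$; (b) $\phi_uT$ and $\phi_vT$ are defined, are semistandard skew tableaux, and $\phi_uT=\phi_vT$. Hence the $P$-tableau of the Sagan–Stanley skew RSK correspondence with empty matrix word depends only on the Knuth class of the insertion order word: if $U,V$ are semistandard skew tableaux with inner border $\mu$ and $R(U)\equiv R(V)$, then the semistandard skew tableau $P$ obtained from $T$ by successive internal insertion at the cells of $U$ in the standard order is defined and equals the one obtained in the same way from the cells of $V$. -/

import Mathlib

/-- A row-by-row description of a filling of a skew shape `λ/μ`, from top to bottom: the `i`-th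
item `(m, l)` says that the inner shape has `m = μ_i` (blank) boxes in row `i` and that the boxes
of `λ/μ` in row `i` carry, from left to right, the labels listed in `l`; thus
`λ_i = m + l.length`.  Rows and columns are indexed from `0`.  Being a (semistandard) tableau is
the predicate `SkewFilling.IsSSYT` below. -/
abbrev SkewFilling := List (ℕ × List ℕ)

namespace SkewFilling

/-- The length `μ_i` of row `i` of the inner shape (`0` below the last row). -/
def inner (T : SkewFilling) (i : ℕ) : ℕ := (T.getD i (0, [])).1

/-- The labels in row `i`, from left to right. -/
def labels (T : SkewFilling) (i : ℕ) : List ℕ := (T.getD i (0, [])).2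

/-- The length `λ_i` of row `i` of the outer shape (`0` below the last row). -/
def outer (T : SkewFilling) (i : ℕ) : ℕ := T.inner i + (T.labels i).length

/-- The box in row `i` and column `j` belongs to the skew shape `λ/μ`. -/
def HasBox (T : SkewFilling) (i j : ℕ) : Prop := T.inner i ≤ j ∧ j < T.outer i

/-- The label of the box in row `i` and column `j` (only meaningful for boxes of `λ/μ`). -/
def entry (T : SkewFilling) (i j : ℕ) : ℕ := (T.labels i).getD (j - T.inner i) 0

/-- Semistandard skew tableaux: `μ ⊆ λ` are partitions, the labels are positive integers, weakly
increasing from left to right along rows and strictly increasing from top to bottom along columns.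
The list of rows has exactly `ℓ(λ)` items (no row of the outer shape `λ` is empty), so that
equality of lists is equality of tableaux. -/
structure IsSSYT (T : SkewFilling) : Prop where
  inner_antitone : Antitone T.inner
  outer_antitone : Antitone T.outer
  row_ne_empty : ∀ i < T.length, 0 < T.outer i
  entry_pos : ∀ i j, T.HasBox i j → 0 < T.entry i j
  row_weak : ∀ i j₁ j₂, j₁ < j₂ → T.HasBox i j₁ → T.HasBox i j₂ → T.entry i j₁ ≤ T.entry i j₂
  col_strict : ∀ i₁ i₂ j, i₁ < i₂ → T.HasBox i₁ j → T.HasBox i₂ j → T.entry i₁ j < T.entry i₂ j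

/-- Two skew fillings share their inner border `μ`. -/
def SameInner (T U : SkewFilling) : Prop := ∀ i, T.inner i = U.inner i

/-! ### Standard order and companion word -/

/-- The boxes `(row, column)` of the skew shape. -/
def boxes (U : SkewFilling) : List (ℕ × ℕ) :=
  (List.range U.length).flatMap fun i =>
    (List.range (U.labels i).length).map fun t => (i, U.inner i + t)

/-- The boxes of `U` in the standard order: by increasing label, and among equal labels from left
to right.  The `p`-th box of this list (`p = 1, 2, …`) is the one that carries the number `p` in
the standardisation of `U`. -/
def standardOrder (U : SkewFilling) : List (ℕ × ℕ) :=
  U.boxes.insertionSort fun c d =>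
    U.entry c.1 c.2 < U.entry d.1 d.2 ∨ (U.entry c.1 c.2 = U.entry d.1 d.2 ∧ c.2 ≤ d.2)

/-- The companion word `R(U) = u_{|U|} ⋯ u_2 u_1`, where `u_p` is the row of the box that carries
the number `p` in the standardisation of `U`. -/
def companionWord (U : SkewFilling) : List ℕ := (U.standardOrder.map Prod.fst).reverse

/-- `u` is an internal insertion order word of `T`: the companion word of some semistandard skew
tableau with the same inner border as `T`. -/
def IsInternalInsertionOrderWord (T : SkewFilling) (u : List ℕ) : Prop :=
  ∃ U : SkewFilling, U.IsSSYT ∧ T.SameInner U ∧ U.companionWord = u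

/-! ### Row insertion and internal row insertion -/

/-- Schensted insertion of `x` into one row: `x` replaces the leftmost label greater than `x`,
which is bumped (second component), or settles at the end of the row if there is none. -/
def rowInsert (x : ℕ) : List ℕ → List ℕ × Option ℕ
  | [] => ([x], none)
  | y :: l => if x < y then (x :: l, some y) else (y :: (rowInsert x l).1, (rowInsert x l).2)

/-- Row insertion of `x` into the first of the given rows, each bumped label being inserted into
the next row, until a label settles at the end of a (possibly new) row. -/
def insertRows (x : ℕ) : SkewFilling → SkewFilling
  | [] => [(0, [x])]
  | (m, l) :: rest =>
    match rowInsert x l with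
    | (l', none) => (m, l') :: rest
    | (l', some y) => (m, l') :: insertRows y rest

/-- Turn the first box of row `i` outside the inner shape into a blank box of the inner shape, and
row insert the label that it carried, if any, into row `i + 1`. -/
def vacate : ℕ → SkewFilling → SkewFilling
  | 0, [] => [(1, [])]
  | 0, (m, []) :: rest => (m + 1, []) :: rest
  | 0, (m, x :: l) :: rest => (m + 1, l) :: insertRows x rest
  | _ + 1, [] => []
  | i + 1, r :: rest => r :: vacate i rest

/-- The cell `(i, j)` is an inner corner of `T`, filled or empty: it is the first cell of row `i`
outside the inner shape `μ`, and adjoining it to `μ` gives a partition.  (If `(i, j)` is a box of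
`λ/μ`, this says that `(i - 1, j)` and `(i, j - 1)` are not boxes of `λ/μ`.) -/
def IsInnerCorner (T : SkewFilling) (i j : ℕ) : Prop :=
  j = T.inner i ∧ (i = 0 ∨ T.inner i < T.inner (i - 1))

instance (T : SkewFilling) (i j : ℕ) : Decidable (T.IsInnerCorner i j) := by
  unfold IsInnerCorner
  infer_instance

/-- Internal row insertion of `T` at the cell `c`; undefined (`none`) unless `c` is an inner
corner. -/
def internalInsert (T : SkewFilling) (c : ℕ × ℕ) : Option SkewFilling :=
  if T.IsInnerCorner c.1 c.2 then some (vacate c.1 T) else none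

/-- The row internal insertion operator `φ_i`. -/
def phi (i : ℕ) (T : SkewFilling) : Option SkewFilling := T.internalInsert (i, T.inner i)

/-- The composite `φ_u = φ_{u_m} ⋯ φ_{u_2} φ_{u_1}` for the word `u = u_m ⋯ u_2 u_1`: the last
letter of `u` acts first. -/
def phiWord : List ℕ → SkewFilling → Option SkewFilling
  | [], T => some T
  | a :: u, T => (phiWord u T).bind (phi a)

/-- The `P`-tableau of the skew RSK correspondence with empty matrix word, for a pair `(T, U)`
sharing an inner border: internally insert `T` successively at the cells of `U` taken in the
standard order. -/
def skewRSKP (T U : SkewFilling) : Option SkewFilling :=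
  U.standardOrder.foldlM internalInsert T

end SkewFilling

/-- Elementary Knuth relations: `x z y ≡ z x y` for `x ≤ y < z` and `y z x ≡ y x z` for
`x < y ≤ z`, inside a word. -/
inductive KnuthStep : List ℕ → List ℕ → Prop
  | xzy (w₁ w₂ : List ℕ) (x y z : ℕ) (hxy : x ≤ y) (hyz : y < z) :
      KnuthStep (w₁ ++ [x, z, y] ++ w₂) (w₁ ++ [z, x, y] ++ w₂)
  | yzx (w₁ w₂ : List ℕ) (x y z : ℕ) (hxy : x < y) (hyz : y ≤ z) :
      KnuthStep (w₁ ++ [y, z, x] ++ w₂) (w₁ ++ [y, x, z] ++ w₂)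

/-- Knuth equivalence of words: the equivalence relation generated by the Knuth relations. -/
def KnuthEquiv : List ℕ → List ℕ → Prop := Relation.EqvGen KnuthStep

/-! List the boxes of a tableau in the standard order as pairs (label, row). Together with the inner
border this list determines the tableau, and semistandardness says that the list is sorted and that
its rows, added one by one to the inner border, run through partitions (`IsReading`). The operator
`φ_c` keeps the sequence of labels: it goes through the list once, and the boxes of its bumping path
move down one row (`scan`, `labels_vacate`).

A word of operators can therefore traverse the list box by box instead of letter by letter
(`scanWord_cons`): each box turns the word into another word and is itself put in a new row, by the
local growth rule `passBox`. A finite check shows that two words differing by a Knuth relation send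
the box to the same row and come out differing again by a Knuth relation (`KnuthStep.passBox`), so
induction on the list gives equal labels. The new inner borders agree because Knuth equivalent words
have the same content.

The internal insertion order words are the words which, read from right to left, add boxes to the
inner border through partitions; this property is Knuth invariant (`KnuthStep.isLattice`) and makes
every operator in the composite defined. -/

/-! ### Lattice words relative to a border -/

/-- Adjoin a box to row `r` of a composition. -/
def addBox (μ : ℕ → ℕ) (r : ℕ) : ℕ → ℕ := fun i => μ i + if i = r then 1 else 0

/-- Adjoining boxes to `μ` in the rows listed in `w`, from left to right, passes through
partitions only. -/
def IsLattice : (ℕ → ℕ) → List ℕ → Prop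
  | μ, [] => Antitone μ
  | μ, r :: w => Antitone μ ∧ IsLattice (addBox μ r) w

theorem IsLattice.antitone {μ : ℕ → ℕ} {w : List ℕ} (h : IsLattice μ w) : Antitone μ := by
  cases w with
  | nil => exact h
  | cons r w => exact h.1

theorem isLattice_append {μ : ℕ → ℕ} {w w' : List ℕ} :
    IsLattice μ (w ++ w') ↔ IsLattice μ w ∧ IsLattice (w.foldl addBox μ) w' := by
  induction w generalizing μ with
  | nil => exact ⟨fun h => ⟨h.antitone, h⟩, fun h => h.2⟩
  | cons r w ih => simp only [List.cons_append, IsLattice, ih, List.foldl_cons, and_assoc]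

theorem foldl_addBox (μ : ℕ → ℕ) (w : List ℕ) (i : ℕ) :
    w.foldl addBox μ i = μ i + w.count i := by
  induction w generalizing μ with
  | nil => rfl
  | cons r w ih =>
    simp only [List.foldl_cons, ih, addBox, List.count_cons, beq_iff_eq, eq_comm (a := i)]
    omega

theorem isLattice_iff_prefix {μ : ℕ → ℕ} {w : List ℕ} :
    IsLattice μ w ↔ ∀ a b, w = a ++ b → Antitone fun i => μ i + a.count i := by
  constructor
  · rintro h a b rfl
    have := (isLattice_append.1 h).2.antitone
    simpa only [funext (foldl_addBox μ a)] using this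
  · intro h
    induction w generalizing μ with
    | nil => simpa [IsLattice] using h [] [] rfl
    | cons r w ih =>
      refine ⟨by simpa using h [] _ rfl, ih fun a b hab => ?_⟩
      convert h (r :: a) b (by rw [hab]; rfl) using 2 with i
      simp only [addBox, List.count_cons, beq_iff_eq, eq_comm (a := i)]
      omega

theorem antitone_addBox {μ : ℕ → ℕ} (h : Antitone μ) {r : ℕ} :
    Antitone (addBox μ r) ↔ r = 0 ∨ μ r < μ (r - 1) := by
  constructor
  · intro h'
    rcases Nat.eq_zero_or_pos r with rfl | hr
    · exact Or.inl rfl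
    · have := h' (Nat.sub_le r 1)
      have h1 : r - 1 ≠ r := by omega
      simp only [addBox, if_true, h1, if_false] at this
      omega
  · intro h'
    refine antitone_nat_of_succ_le fun n => ?_
    have : μ (n + 1) ≤ μ n := h (Nat.le_succ n)
    simp only [addBox]
    by_cases h1 : n + 1 = r
    · subst h1
      simp at h' ⊢
      omega
    · rw [if_neg h1]; omega

theorem addBox_comm (μ : ℕ → ℕ) (r s : ℕ) : addBox (addBox μ r) s = addBox (addBox μ s) r := by
  funext i; simp only [addBox]; omega

/-- The two words visit the same shapes except for the one after the first box. -/
theorem isLattice_swap {μ : ℕ → ℕ} {x z : ℕ} {w : List ℕ}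
    (hμ : Antitone (addBox μ x) ↔ Antitone (addBox μ z)) :
    IsLattice μ (x :: z :: w) ↔ IsLattice μ (z :: x :: w) := by
  simp only [IsLattice, hμ, addBox_comm μ x z]

/-- Being a lattice word, read from right to left, is invariant under Knuth relations. -/
theorem KnuthStep.isLattice {u v : List ℕ} (h : KnuthStep u v) (μ : ℕ → ℕ) :
    IsLattice μ u.reverse ↔ IsLattice μ v.reverse := by
  cases h with
  | xzy w₁ w₂ x y z hxy hyz =>
    simp only [List.reverse_append, List.reverse_cons, List.reverse_nil, List.nil_append,
      List.cons_append, isLattice_append]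
    refine and_congr_right fun _ => ?_
    generalize w₂.reverse.foldl addBox μ = s
    generalize w₁.reverse = w
    have key : ∀ a b, IsLattice s (y :: a :: b :: w) → Antitone s ∧ Antitone (addBox s y) ∧
        Antitone (addBox (addBox s y) a) ∧ Antitone (addBox (addBox (addBox s y) a) b) :=
      fun a b h => ⟨h.1, h.2.1, h.2.2.1, h.2.2.2.antitone⟩
    -- The order of `x` and `z` can matter only if `z = x + 1`. Then `y = x`, and the box `y`
    -- already makes row `x` longer than row `z`.
    have aux : Antitone s → Antitone (addBox s y) →
        Antitone (addBox (addBox (addBox s y) z) x) →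
        (Antitone (addBox (addBox s y) z) ↔ Antitone (addBox (addBox s y) x)) := by
      intro h0 h1 h3
      have e1 := @h3 (z - 1) z (Nat.sub_le _ _)
      have e2 := @h3 (x - 1) x (Nat.sub_le _ _)
      have e3 := @h0 (z - 1) z (Nat.sub_le _ _)
      rw [antitone_addBox h1, antitone_addBox h1]
      simp only [addBox] at e1 e2 e3 ⊢
      grind (splits := 20)
    constructor
    · intro h
      obtain ⟨h0, h1, h2, h3⟩ := key _ _ h
      exact ⟨h0, (isLattice_swap (aux h0 h1 h3)).1 h.2⟩
    · intro h
      obtain ⟨h0, h1, h2, h3⟩ := key _ _ h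
      rw [addBox_comm] at h3
      exact ⟨h0, (isLattice_swap (aux h0 h1 h3)).2 h.2⟩
  | yzx w₁ w₂ x y z hxy hyz =>
    simp only [List.reverse_append, List.reverse_cons, List.reverse_nil, List.nil_append,
      List.cons_append, isLattice_append]
    refine and_congr_right fun _ => ?_
    generalize w₂.reverse.foldl addBox μ = s
    generalize w₁.reverse = w
    -- Again only `z = x + 1` is critical. Then `y = z`, and since two boxes in row `z` and one in
    -- row `x` give a partition, `s z < s x` to begin with.
    have aux : Antitone s → Antitone (addBox (addBox s x) z) →
        Antitone (addBox (addBox (addBox s x) z) y) →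
        (Antitone (addBox s x) ↔ Antitone (addBox s z)) := by
      intro h0 h2 h3
      have e1 := @h3 (z - 1) z (Nat.sub_le _ _)
      have e2 := @h2 (x - 1) x (Nat.sub_le _ _)
      have e3 := @h2 (z - 1) z (Nat.sub_le _ _)
      rw [antitone_addBox h0, antitone_addBox h0]
      simp only [addBox] at e1 e2 e3 ⊢
      grind (splits := 20)
    constructor
    · intro h
      exact (isLattice_swap (aux h.1 h.2.2.1 h.2.2.2.antitone)).1 h
    · intro h
      have h2 := h.2.2.1
      have h3 := h.2.2.2.antitone
      rw [addBox_comm s z x] at h2 h3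
      exact (isLattice_swap (aux h.1 h2 h3)).2 h

/-! ### Scanning a list of boxes, and Knuth relations -/

/-- The action of `φ_c` on the list of `(label, row)` of the boxes of a tableau, in the standard
order: the first box in row `c` moves to row `c + 1`, then the next box in row `c + 1` moves to
row `c + 2`, and so on. -/
def scan : ℕ → List (ℕ × ℕ) → List (ℕ × ℕ)
  | _, [] => []
  | c, (v, r) :: t => if r = c then (v, c + 1) :: scan (c + 1) t else (v, r) :: scan c t

/-- The composite of the operators `scan c`, the last letter of the word acting first. -/
def scanWord (u : List ℕ) (t : List (ℕ × ℕ)) : List (ℕ × ℕ) := u.foldr scan t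

/-- The local rule of the growth diagram: boxes adjoined in the rows `a ≠ r` commute, and two boxes
adjoined in the same row are replaced by boxes in the next row. -/
def push (a r : ℕ) : ℕ := if a = r then a + 1 else a

/-- The local rule for `scan`: a word `u` passes through a box in row `r`. -/
def passBox : List ℕ → ℕ → List ℕ × ℕ
  | [], r => ([], r)
  | a :: u, r =>
    let p := passBox u r
    (push a p.2 :: p.1, push p.2 a)

/-- The change of viewpoint that permits induction on the boxes: the whole word acts on the first
box, and what becomes of it acts on the rest. -/
theorem scanWord_cons (u : List ℕ) (v r : ℕ) (t : List (ℕ × ℕ)) :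
    scanWord u ((v, r) :: t) = (v, (passBox u r).2) :: scanWord (passBox u r).1 t := by
  induction u with
  | nil => rfl
  | cons a u ih =>
    simp only [scanWord, List.foldr_cons] at ih ⊢
    rw [ih]
    simp only [scan, passBox, push, eq_comm (a := a)]
    split_ifs with h <;> simp [h]

theorem scanWord_nil (u : List ℕ) : scanWord u [] = [] := by
  induction u with
  | nil => rfl
  | cons a u ih => simp only [scanWord, List.foldr_cons] at ih ⊢; rw [ih]; rfl

theorem passBox_append (u w : List ℕ) (r : ℕ) :
    passBox (u ++ w) r = ((passBox u (passBox w r).2).1 ++ (passBox w r).1,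
      (passBox u (passBox w r).2).2) := by
  induction u with
  | nil => rfl
  | cons a u ih =>
    simp only [List.cons_append, passBox, ih]

theorem KnuthStep.append_append {u v : List ℕ} (h : KnuthStep u v) (a b : List ℕ) :
    KnuthStep (a ++ u ++ b) (a ++ v ++ b) := by
  cases h with
  | xzy w₁ w₂ x y z hxy hyz =>
    simpa [List.append_assoc] using KnuthStep.xzy (a ++ w₁) (w₂ ++ b) x y z hxy hyz
  | yzx w₁ w₂ x y z hxy hyz =>
    simpa [List.append_assoc] using KnuthStep.yzx (a ++ w₁) (w₂ ++ b) x y z hxy hyz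

theorem passBox_xzy {x y z : ℕ} (hxy : x ≤ y) (hyz : y < z) (r : ℕ) :
    (passBox [x, z, y] r).2 = (passBox [z, x, y] r).2 ∧
      KnuthStep (passBox [x, z, y] r).1 (passBox [z, x, y] r).1 := by
  have key := fun a b c h h' => KnuthStep.xzy [] [] a b c h h'
  simp only [List.nil_append, List.append_nil] at key
  simp only [passBox]
  simp only [push]
  split_ifs <;> first
    | omega
    | exact ⟨by omega, key _ _ _ (by omega) (by omega)⟩

theorem passBox_yzx {x y z : ℕ} (hxy : x < y) (hyz : y ≤ z) (r : ℕ) :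
    (passBox [y, z, x] r).2 = (passBox [y, x, z] r).2 ∧
      KnuthStep (passBox [y, z, x] r).1 (passBox [y, x, z] r).1 := by
  have key := fun a b c h h' => KnuthStep.yzx [] [] a b c h h'
  have key' := fun a b c h h' => KnuthStep.xzy [] [] a b c h h'
  simp only [List.nil_append, List.append_nil] at key key'
  simp only [passBox]
  simp only [push]
  split_ifs <;> first
    | omega
    | exact ⟨by omega, key _ _ _ (by omega) (by omega)⟩
    -- The one case where the type of relation changes: for `y = z = x + 1` and `r = x` the words
    -- become `[x+1, x+2, x+1]` and `[x+2, x+1, x+1]`, related by the other Knuth relation.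
    | (obtain rfl : y = z := by omega
       obtain rfl : y = x + 1 := by omega
       exact ⟨by omega, key' _ _ _ (by omega) (by omega)⟩)

/-- A box passes in the same way through two Knuth-related words, and they stay Knuth-related. -/
theorem KnuthStep.passBox {u v : List ℕ} (h : KnuthStep u v) (r : ℕ) :
    (passBox u r).2 = (passBox v r).2 ∧ KnuthStep (passBox u r).1 (passBox v r).1 := by
  cases h with
  | xzy w₁ w₂ x y z hxy hyz =>
    obtain ⟨h1, h2⟩ := passBox_xzy hxy hyz (_root_.passBox w₂ r).2
    simp only [List.append_assoc, passBox_append, h1, true_and]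
    simpa only [List.append_assoc] using h2.append_append _ _
  | yzx w₁ w₂ x y z hxy hyz =>
    obtain ⟨h1, h2⟩ := passBox_yzx hxy hyz (_root_.passBox w₂ r).2
    simp only [List.append_assoc, passBox_append, h1, true_and]
    simpa only [List.append_assoc] using h2.append_append _ _

/-- Both words vary in the induction, since every box passed modifies them. -/
theorem KnuthStep.scanWord_eq {u v : List ℕ} (h : KnuthStep u v) (t : List (ℕ × ℕ)) :
    scanWord u t = scanWord v t := by
  induction t generalizing u v with
  | nil => rw [scanWord_nil, scanWord_nil]
  | cons p t ih =>
    obtain ⟨a, r⟩ := p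
    obtain ⟨h1, h2⟩ := h.passBox r
    rw [scanWord_cons, scanWord_cons, h1, ih h2]

theorem KnuthStep.perm {u v : List ℕ} (h : KnuthStep u v) : u.Perm v := by
  cases h with
  | xzy w₁ w₂ x y z _ _ =>
    exact ((List.Perm.swap z x [y]).append_left w₁).append_right w₂
  | yzx w₁ w₂ x y z _ _ =>
    exact (((List.Perm.swap x z []).cons y).append_left w₁).append_right w₂

theorem KnuthEquiv.invariants {u v : List ℕ} (h : KnuthEquiv u v) :
    (∀ μ, IsLattice μ u.reverse ↔ IsLattice μ v.reverse) ∧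
      (∀ t, scanWord u t = scanWord v t) ∧ u.Perm v := by
  induction h with
  | rel _ _ h => exact ⟨h.isLattice, h.scanWord_eq, h.perm⟩
  | refl => exact ⟨fun _ => Iff.rfl, fun _ => rfl, List.Perm.refl _⟩
  | symm _ _ _ ih => exact ⟨fun μ => (ih.1 μ).symm, fun t => (ih.2.1 t).symm, ih.2.2.symm⟩
  | trans _ _ _ _ _ ih ih' =>
    exact ⟨fun μ => (ih.1 μ).trans (ih'.1 μ), fun t => (ih.2.1 t).trans (ih'.2.1 t),
      ih.2.2.trans ih'.2.2⟩

/-! ### Scanning preserves sorted lattice lists -/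

/-- The standard order on `(label, row)`. -/
def StdLE (p q : ℕ × ℕ) : Prop := p.1 < q.1 ∨ p.1 = q.1 ∧ q.2 ≤ p.2

instance : IsTrans (ℕ × ℕ) StdLE := ⟨fun a b c h h' => by unfold StdLE at *; omega⟩

theorem map_fst_scan (c : ℕ) (t : List (ℕ × ℕ)) : (scan c t).map Prod.fst = t.map Prod.fst := by
  induction t generalizing c with
  | nil => rfl
  | cons p t ih =>
    obtain ⟨v, r⟩ := p
    simp only [scan]
    split_ifs <;> simp [ih]

/-- Labels are kept, so only neighbours with equal labels matter; their rows weakly decrease. If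
just the second one moves, it was in row `c` and the first strictly below, so the order survives. -/
theorem isChain_scan {t : List (ℕ × ℕ)} (h : t.IsChain StdLE) (c : ℕ) :
    (scan c t).IsChain StdLE := by
  induction t generalizing c with
  | nil => exact List.isChain_nil
  | cons p t ih =>
    obtain ⟨v, r⟩ := p
    cases t with
    | nil => simp only [scan]; split_ifs <;> exact List.isChain_singleton _
    | cons q t =>
      obtain ⟨v', r'⟩ := q
      rw [List.isChain_cons_cons] at h
      have h1 := h.1
      have ih1 := ih h.2 c
      have ih2 := ih h.2 (c + 1)
      simp only [StdLE] at h1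
      simp only [scan] at ih1 ih2 ⊢
      split_ifs at ih1 ih2 ⊢ <;> first | omega | (
        refine List.isChain_cons_cons.2 ⟨?_, by assumption⟩
        simp only [StdLE]
        omega)

theorem pairwise_scan {t : List (ℕ × ℕ)} (h : t.Pairwise StdLE) (c : ℕ) :
    (scan c t).Pairwise StdLE :=
  List.isChain_iff_pairwise.1 (isChain_scan (List.isChain_iff_pairwise.2 h) c)

/-- The growth diagram: each square has sides `r` and `c`. If `r ≠ c` the two boxes commute; if `r =
c`, row `r + 1` can receive a box because row `r` has just become longer. -/
theorem isLattice_scan {μ : ℕ → ℕ} {t : List (ℕ × ℕ)} (h : IsLattice μ (t.map Prod.snd)) {c : ℕ}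
    (hc : Antitone (addBox μ c)) : IsLattice (addBox μ c) ((scan c t).map Prod.snd) := by
  induction t generalizing μ c with
  | nil => exact hc
  | cons p t ih =>
    obtain ⟨v, r⟩ := p
    have h1 := h.1
    have h2 : IsLattice (addBox μ r) (t.map Prod.snd) := h.2
    simp only [scan]
    split_ifs with hr
    · subst hr
      refine ⟨hc, ih h2 ((antitone_addBox hc).2 (Or.inr ?_))⟩
      have := h1 (Nat.le_succ r)
      simp [addBox]
      omega
    · refine ⟨hc, ?_⟩
      have h3 := h2.antitone
      rw [addBox_comm]
      refine ih h2 ((antitone_addBox h3).2 ?_)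
      rw [antitone_addBox h1] at hc
      simp only [addBox]
      split_ifs <;> omega

/-! ### Recovering a sorted list from its rows -/

/-- The labels of the boxes in row `i`. -/
def rowLabels (t : List (ℕ × ℕ)) (i : ℕ) : List ℕ := (t.filter fun p => p.2 = i).map Prod.fst

theorem rowLabels_append (t t' : List (ℕ × ℕ)) (i : ℕ) :
    rowLabels (t ++ t') i = rowLabels t i ++ rowLabels t' i := by simp [rowLabels]

theorem rowLabels_cons (v r : ℕ) (t : List (ℕ × ℕ)) (i : ℕ) :
    rowLabels ((v, r) :: t) i = if r = i then v :: rowLabels t i else rowLabels t i := by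
  simp only [rowLabels, List.filter_cons, decide_eq_true_eq]
  split_ifs <;> rfl

theorem mem_rowLabels {t : List (ℕ × ℕ)} {i v : ℕ} : v ∈ rowLabels t i ↔ (v, i) ∈ t := by
  simp [rowLabels]

theorem length_rowLabels (t : List (ℕ × ℕ)) (i : ℕ) :
    (rowLabels t i).length = (t.map Prod.snd).count i := by
  induction t with
  | nil => rfl
  | cons p t ih =>
    obtain ⟨v, r⟩ := p
    rw [rowLabels_cons, List.map_cons, List.count_cons]
    split_ifs <;> simp_all

theorem count_rowLabels (t : List (ℕ × ℕ)) (v i : ℕ) : (rowLabels t i).count v = t.count (v, i) := by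
  induction t with
  | nil => rfl
  | cons p t ih =>
    obtain ⟨w, r⟩ := p
    rw [rowLabels_cons, List.count_cons]
    split_ifs <;> simp_all

theorem eq_append_of_rowLabels_eq {t : List (ℕ × ℕ)} {i v : ℕ} {a b : List ℕ}
    (h : rowLabels t i = a ++ v :: b) :
    ∃ t₁ t₂, t = t₁ ++ (v, i) :: t₂ ∧ rowLabels t₁ i = a ∧ rowLabels t₂ i = b := by
  induction t generalizing a with
  | nil => simp [rowLabels] at h
  | cons p t ih =>
    obtain ⟨w, r⟩ := p
    rw [rowLabels_cons] at h
    split_ifs at h with hr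
    · subst hr
      cases a with
      | nil =>
        simp only [List.nil_append, List.cons.injEq] at h
        exact ⟨[], t, by simp [h.1], rfl, h.2⟩
      | cons c a =>
        simp only [List.cons_append, List.cons.injEq] at h
        obtain ⟨t₁, t₂, rfl, h1, h2⟩ := ih h.2
        exact ⟨(w, r) :: t₁, t₂, rfl, by rw [rowLabels_cons, if_pos rfl, h1, h.1], h2⟩
    · obtain ⟨t₁, t₂, rfl, h1, h2⟩ := ih h
      exact ⟨(w, r) :: t₁, t₂, rfl, by rw [rowLabels_cons, if_neg hr, h1], h2⟩

/-- `StdLE` is antisymmetric, so a sorted list is determined by its multiplicities, which the rows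
record. -/
theorem eq_of_rowLabels_eq {t t' : List (ℕ × ℕ)} (ht : t.Pairwise StdLE)
    (ht' : t'.Pairwise StdLE) (h : ∀ i, rowLabels t i = rowLabels t' i) : t = t' := by
  refine List.Perm.eq_of_pairwise (fun a b _ _ h h' => ?_) ht ht' ?_
  · unfold StdLE at h h'
    ext <;> omega
  · rw [List.perm_iff_count]
    rintro ⟨v, i⟩
    rw [← count_rowLabels, h, count_rowLabels]

theorem scan_append_of_rowLabels_eq_nil {t : List (ℕ × ℕ)} {c : ℕ} (h : rowLabels t c = [])
    (t' : List (ℕ × ℕ)) : scan c (t ++ t') = t ++ scan c t' := by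
  induction t with
  | nil => rfl
  | cons p t ih =>
    obtain ⟨v, r⟩ := p
    rw [rowLabels_cons] at h
    split_ifs at h with hr
    simp only [List.cons_append, scan, if_neg hr, ih h]

theorem scan_of_rowLabels_eq_nil {t : List (ℕ × ℕ)} {c : ℕ} (h : rowLabels t c = []) :
    scan c t = t := by
  simpa [scan] using scan_append_of_rowLabels_eq_nil h []

/-! ### Semistandard tableaux as sorted lattice lists -/

namespace SkewFilling

/-- `t` lists the pairs `(label, row)` of the boxes of the tableau `T` in the standard order. -/
structure IsReading (T : SkewFilling) (t : List (ℕ × ℕ)) : Prop where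
  labels_eq : ∀ i, T.labels i = rowLabels t i
  sorted : t.Pairwise StdLE
  lattice : IsLattice T.inner (t.map Prod.snd)
  pos : ∀ p ∈ t, 0 < p.1
  row_pos : ∀ r ∈ T, 0 < r.1 + r.2.length

theorem outer_eq_getElem {T : SkewFilling} {i : ℕ} (h : i < T.length) :
    T.outer i = T[i].1 + T[i].2.length := by
  rw [outer, inner, labels, List.getD_eq_getElem _ _ h]

theorem outer_of_length_le {T : SkewFilling} {i : ℕ} (h : T.length ≤ i) : T.outer i = 0 := by
  rw [outer, inner, labels, List.getD_eq_default _ _ h]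
  rfl

theorem inner_of_length_le {T : SkewFilling} {i : ℕ} (h : T.length ≤ i) : T.inner i = 0 := by
  rw [inner, List.getD_eq_default _ _ h]

/-- Without empty rows, the outer shape fixes the number of rows in the list. -/
theorem ext_of_row_pos {T U : SkewFilling} (hT : ∀ r ∈ T, 0 < r.1 + r.2.length)
    (hU : ∀ r ∈ U, 0 < r.1 + r.2.length) (hi : ∀ i, T.inner i = U.inner i)
    (hl : ∀ i, T.labels i = U.labels i) : T = U := by
  have key : ∀ {T : SkewFilling}, (∀ r ∈ T, 0 < r.1 + r.2.length) →
      ∀ i, i < T.length ↔ 0 < T.outer i := by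
    intro T hT i
    constructor
    · intro h
      rw [outer_eq_getElem h]
      exact hT _ (List.getElem_mem h)
    · intro h
      by_contra! h'
      rw [outer_of_length_le h'] at h
      exact lt_irrefl _ h
  have hlen : T.length = U.length := by
    have : ∀ i, i < T.length ↔ i < U.length := fun i => by
      rw [key hT, key hU, outer, outer, hi, hl]
    have h1 := this T.length
    have h2 := this U.length
    omega
  refine List.ext_getElem hlen fun i h h' => ?_
  have h1 := hi i
  have h2 := hl i
  rw [inner, inner, List.getD_eq_getElem _ _ h, List.getD_eq_getElem _ _ h'] at h1
  rw [labels, labels, List.getD_eq_getElem _ _ h, List.getD_eq_getElem _ _ h'] at h2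
  exact Prod.ext h1 h2

theorem IsReading.outer_eq {T : SkewFilling} {t : List (ℕ × ℕ)} (h : T.IsReading t) (i : ℕ) :
    T.outer i = T.inner i + (t.map Prod.snd).count i := by
  rw [outer, h.labels_eq, length_rowLabels]

theorem IsReading.exists_split {T : SkewFilling} {t : List (ℕ × ℕ)} (h : T.IsReading t) {i j : ℕ}
    (hij : T.HasBox i j) : ∃ t₁ t₂, t = t₁ ++ (T.entry i j, i) :: t₂ ∧
      j = T.inner i + (t₁.map Prod.snd).count i := by
  obtain ⟨h1, h2⟩ := hij
  have hk : j - T.inner i < (rowLabels t i).length := by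
    rw [outer, h.labels_eq] at h2
    omega
  have hs := (List.take_append_drop (j - T.inner i) (rowLabels t i)).symm
  rw [List.drop_eq_getElem_cons hk] at hs
  obtain ⟨t₁, t₂, ht, ht₁, -⟩ := eq_append_of_rowLabels_eq hs
  refine ⟨t₁, t₂, ?_, ?_⟩
  · rw [entry, h.labels_eq, List.getD_eq_getElem _ _ hk]
    exact ht
  · rw [← length_rowLabels, ht₁, List.length_take]
    omega

theorem IsReading.mem_of_lt {T : SkewFilling} {t₁ t₂ : List (ℕ × ℕ)} (h : T.IsReading (t₁ ++ t₂))
    {i j : ℕ} (hj : T.inner i ≤ j) (hj' : j < T.inner i + (t₁.map Prod.snd).count i) :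
    (T.entry i j, i) ∈ t₁ := by
  rw [← length_rowLabels] at hj'
  have hk : j - T.inner i < (rowLabels t₁ i).length := by omega
  rw [← mem_rowLabels, entry, h.labels_eq, rowLabels_append, List.getD_append _ _ _ _ hk,
    List.getD_eq_getElem _ _ hk]
  exact List.getElem_mem hk

theorem IsReading.isSSYT {T : SkewFilling} {t : List (ℕ × ℕ)} (h : T.IsReading t) :
    T.IsSSYT where
  inner_antitone := h.lattice.antitone
  outer_antitone := by
    rw [funext h.outer_eq]
    exact isLattice_iff_prefix.1 h.lattice _ [] (List.append_nil _).symm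
  row_ne_empty i hi := by
    rw [outer_eq_getElem hi]
    exact h.row_pos _ (List.getElem_mem hi)
  entry_pos i j hij := by
    obtain ⟨t₁, t₂, rfl, -⟩ := h.exists_split hij
    exact h.pos _ (List.mem_append_right _ List.mem_cons_self)
  row_weak i j₁ j₂ hj h₁ h₂ := by
    obtain ⟨t₁, t₂, ht, hj₂⟩ := h.exists_split h₂
    rw [ht] at h
    have hm := h.mem_of_lt h₁.1 (hj₂ ▸ hj)
    have := (List.pairwise_append.1 h.sorted).2.2 _ hm _ List.mem_cons_self
    simp only [StdLE] at this
    omega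
  col_strict i₁ i₂ j hi h₁ h₂ := by
    obtain ⟨t₁, t₂, ht, hj₂⟩ := h.exists_split h₂
    rw [ht] at h
    -- The prefix includes the lower box: its shape is a partition, so the upper box of the column
    -- comes earlier. As `StdLE` puts lower rows first among equal labels, the upper label is
    -- strictly smaller.
    have hanti := isLattice_iff_prefix.1 h.lattice (t₁.map Prod.snd ++ [i₂]) (t₂.map Prod.snd)
      (by simp) hi.le
    have h0 : i₁ ≠ i₂ := hi.ne
    simp only [List.count_append, List.count_singleton, beq_self_eq_true, if_true, beq_iff_eq,
      h0.symm, if_false] at hanti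
    have hm := h.mem_of_lt h₁.1 (by omega : j < _)
    have := (List.pairwise_append.1 h.sorted).2.2 _ hm _ List.mem_cons_self
    simp only [StdLE] at this
    omega

theorem exists_isReading {T : SkewFilling} {t : List (ℕ × ℕ)} (ht : t.Pairwise StdLE)
    (hl : IsLattice T.inner (t.map Prod.snd)) (hpos : ∀ p ∈ t, 0 < p.1) :
    ∃ U : SkewFilling, T.SameInner U ∧ U.IsReading t := by
  have hanti : Antitone fun i => T.inner i + (t.map Prod.snd).count i :=
    isLattice_iff_prefix.1 hl _ [] (List.append_nil _).symm
  have hex : ∃ n, T.inner n + (t.map Prod.snd).count n = 0 := by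
    -- A row below all rows of `T` and beyond every row index in `t`, each of which is at most their
    -- sum.
    refine ⟨T.length + (t.map Prod.snd).sum + 1, ?_⟩
    rw [inner_of_length_le (by omega), zero_add, List.count_eq_zero]
    intro hm
    have := List.le_sum_of_mem hm
    omega
  classical
  let n := Nat.find hex
  have hn : ∀ i, i < n ↔ 0 < T.inner i + (t.map Prod.snd).count i := by
    intro i
    constructor
    · intro h
      exact Nat.pos_of_ne_zero (Nat.find_min hex h)
    · intro h
      by_contra! h'
      have h1 := hanti h'
      have h2 : T.inner n + (t.map Prod.snd).count n = 0 := Nat.find_spec hex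
      simp only [h2] at h1
      omega
  let U : SkewFilling := (List.range n).map fun i => (T.inner i, rowLabels t i)
  have hU : ∀ i, U.getD i (0, []) = (T.inner i, rowLabels t i) := by
    intro i
    by_cases hi : i < n
    · simp [U, List.getD_eq_getElem?_getD, hi]
    · have h0 := mt (hn i).2 hi
      have h1 : T.inner i = 0 := by omega
      have h2 : rowLabels t i = [] := by
        rw [← List.length_eq_zero_iff, length_rowLabels]
        omega
      simp [U, List.getD_eq_getElem?_getD, hi, h1, h2]
  have hinner : U.inner = T.inner := funext fun i => by rw [inner, hU]
  refine ⟨U, fun i => by rw [hinner], fun i => by rw [labels, hU], ht, hinner ▸ hl, hpos, ?_⟩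
  intro r hr
  obtain ⟨i, hi, rfl⟩ := List.mem_map.1 hr
  rw [length_rowLabels]
  exact (hn i).1 (List.mem_range.1 hi)

/-! ### The standard order -/

theorem mem_boxes {U : SkewFilling} {c : ℕ × ℕ} : c ∈ U.boxes ↔ U.HasBox c.1 c.2 := by
  obtain ⟨i, j⟩ := c
  simp only [boxes, List.mem_flatMap, List.mem_range, List.mem_map, Prod.mk.injEq, HasBox]
  constructor
  · rintro ⟨i, hi, k, hk, rfl, rfl⟩
    unfold outer
    omega
  · rintro ⟨h1, h2⟩
    refine ⟨i, ?_, j - U.inner i, by unfold outer at h2; omega, rfl, by omega⟩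
    by_contra! h
    rw [outer_of_length_le h] at h2
    omega

theorem nodup_boxes (U : SkewFilling) : U.boxes.Nodup := by
  rw [boxes, List.nodup_flatMap]
  refine ⟨fun i _ => List.nodup_range.map fun a b h => by simpa using h, ?_⟩
  refine List.nodup_range.imp ?_
  intro a b hab
  simp only [Function.onFun, List.Disjoint, List.mem_map]
  rintro _ ⟨_, _, rfl⟩ ⟨_, _, h⟩
  exact hab (congrArg Prod.fst h).symm

theorem perm_standardOrder (U : SkewFilling) : U.standardOrder.Perm U.boxes :=
  List.perm_insertionSort _ _

theorem mem_standardOrder {U : SkewFilling} {c : ℕ × ℕ} :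
    c ∈ U.standardOrder ↔ U.HasBox c.1 c.2 := by
  rw [U.perm_standardOrder.mem_iff, mem_boxes]

theorem nodup_standardOrder (U : SkewFilling) : U.standardOrder.Nodup :=
  U.perm_standardOrder.nodup_iff.2 U.nodup_boxes

theorem pairwise_standardOrder (U : SkewFilling) : U.standardOrder.Pairwise fun c d =>
    U.entry c.1 c.2 < U.entry d.1 d.2 ∨ (U.entry c.1 c.2 = U.entry d.1 d.2 ∧ c.2 ≤ d.2) := by
  have : Std.Total fun c d : ℕ × ℕ =>
      U.entry c.1 c.2 < U.entry d.1 d.2 ∨ (U.entry c.1 c.2 = U.entry d.1 d.2 ∧ c.2 ≤ d.2) :=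
    ⟨fun c d => by omega⟩
  have : IsTrans (ℕ × ℕ) fun c d : ℕ × ℕ =>
      U.entry c.1 c.2 < U.entry d.1 d.2 ∨ (U.entry c.1 c.2 = U.entry d.1 d.2 ∧ c.2 ≤ d.2) :=
    ⟨fun a b c h h' => by omega⟩
  exact List.pairwise_insertionSort _ _

theorem IsSSYT.filter_standardOrder {U : SkewFilling} (hU : U.IsSSYT) (i : ℕ) :
    U.standardOrder.filter (fun c => c.1 = i) =
      (List.range (U.labels i).length).map fun k => (i, U.inner i + k) := by
  refine List.Perm.eq_of_pairwise (le := fun c d : ℕ × ℕ => c.2 ≤ d.2) ?_ ?_ ?_ ?_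
  · rintro ⟨a, b⟩ ⟨c, d⟩ h h' h1 h2
    simp only [List.mem_filter, decide_eq_true_eq] at h
    obtain ⟨k, -, hk⟩ := List.mem_map.1 h'
    simp only [Prod.mk.injEq] at hk h1 h2 ⊢
    omega
  · refine (U.pairwise_standardOrder.filter _).imp_of_mem ?_
    rintro ⟨a, b⟩ ⟨c, d⟩ h h' h1
    simp only [List.mem_filter, decide_eq_true_eq, mem_standardOrder] at h h' h1 ⊢
    obtain ⟨h, rfl⟩ := h
    obtain ⟨h', rfl⟩ := h'
    by_contra! hlt
    have := hU.row_weak _ _ _ hlt h' h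
    omega
  · rw [List.pairwise_map]
    exact List.pairwise_lt_range.imp fun h => by simp only; omega
  · rw [List.perm_ext_iff_of_nodup (U.nodup_standardOrder.filter _)
      (List.nodup_range.map fun a b h => by simpa using h)]
    rintro ⟨a, b⟩
    simp only [List.mem_filter, decide_eq_true_eq, mem_standardOrder, List.mem_map,
      List.mem_range, Prod.mk.injEq, HasBox, outer]
    constructor
    · rintro ⟨⟨h1, h2⟩, rfl⟩
      exact ⟨b - U.inner a, by omega, rfl, by omega⟩
    · rintro ⟨k, hk, rfl, rfl⟩
      omega

/-- In row `i`, an initial segment of the standard order consists of the leftmost boxes. -/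
theorem IsSSYT.mem_prefix_iff {U : SkewFilling} (hU : U.IsSSYT) {a b : List (ℕ × ℕ)}
    (h : U.standardOrder = a ++ b) (i j : ℕ) :
    (i, j) ∈ a ↔ U.inner i ≤ j ∧ j < U.inner i + (a.map Prod.fst).count i := by
  have hf := hU.filter_standardOrder i
  have hlen : (a.map Prod.fst).count i = (a.filter fun c => c.1 = i).length := by
    rw [List.count, List.countP_map, List.countP_eq_length_filter]
    congr 1
  rw [h, List.filter_append] at hf
  have hle := congrArg List.length hf
  rw [List.length_append, List.length_map, List.length_range] at hle
  have ha := congrArg (List.take (a.filter fun c => c.1 = i).length) hf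
  rw [List.take_left, ← List.map_take, List.take_range, min_eq_left (by omega)] at ha
  have hm : (i, j) ∈ a ↔ (i, j) ∈ a.filter fun c => c.1 = i := by simp
  rw [hm, hlen, ha]
  simp only [List.mem_map, List.mem_range, Prod.mk.injEq, List.length_map, List.length_range,
    true_and]
  constructor
  · rintro ⟨k, hk, rfl⟩
    omega
  · rintro ⟨h1, h2⟩
    exact ⟨j - U.inner i, by omega, by omega⟩

/-- At its turn, a box is the first cell of its row outside the border grown so far, so inserting at
the cell is applying `φ` of its row. -/
theorem IsSSYT.col_eq {U : SkewFilling} (hU : U.IsSSYT) {a b : List (ℕ × ℕ)} {c : ℕ × ℕ}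
    (h : U.standardOrder = a ++ c :: b) : c.2 = U.inner c.1 + (a.map Prod.fst).count c.1 := by
  have h1 := (hU.mem_prefix_iff (a := a ++ [c]) (b := b) (by simp [h]) c.1 c.2).1 (by simp)
  have h2 := mt (hU.mem_prefix_iff h c.1 c.2).2 (by
    have := U.nodup_standardOrder
    rw [h, List.nodup_append] at this
    exact fun hc => this.2.2 _ hc _ List.mem_cons_self rfl)
  simp at h1 h2
  omega

/-- The pairs `(label, row)` of the boxes of `U` in the standard order. -/
def reading (U : SkewFilling) : List (ℕ × ℕ) :=
  U.standardOrder.map fun c => (U.entry c.1 c.2, c.1)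

theorem companionWord_eq (U : SkewFilling) :
    U.companionWord = (U.reading.map Prod.snd).reverse := by
  simp [companionWord, reading, Function.comp_def]

theorem IsSSYT.isLattice_standardOrder {U : SkewFilling} (hU : U.IsSSYT) :
    IsLattice U.inner (U.standardOrder.map Prod.fst) := by
  rw [isLattice_iff_prefix]
  intro a b hab i i' hi
  obtain ⟨A, B, hAB, rfl, rfl⟩ := List.map_eq_append_iff.1 hab
  rcases hi.eq_or_lt with rfl | hi
  · exact le_rfl
  by_contra! hlt
  have h0 := hU.inner_antitone hi.le
  have hout := hU.outer_antitone hi.le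
  set j := U.inner i' + (A.map Prod.fst).count i' - 1 with hj
  -- If a prefix were not a partition, the last box of the longer lower row would precede the box
  -- above it, against column strictness.
  have hA' : (i', j) ∈ A := (hU.mem_prefix_iff hAB i' j).2 (by omega)
  have hbox' : U.HasBox i' j :=
    mem_standardOrder.1 (hAB ▸ List.mem_append_left B hA')
  have hbox : U.HasBox i j := ⟨by omega, hbox'.2.trans_le hout⟩
  have hB : (i, j) ∈ B := by
    have hm : (i, j) ∈ A ++ B := hAB ▸ mem_standardOrder.2 hbox
    rcases List.mem_append.1 hm with hm | hm
    · have := ((hU.mem_prefix_iff hAB i j).1 hm).2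
      omega
    · exact hm
  have hs := U.pairwise_standardOrder
  rw [hAB] at hs
  have h1 := (List.pairwise_append.1 hs).2.2 _ hA' _ hB
  have h2 := hU.col_strict i i' j hi hbox hbox'
  simp only at h1
  omega

theorem IsSSYT.isReading {U : SkewFilling} (hU : U.IsSSYT) : U.IsReading U.reading where
  labels_eq i := by
    have h : rowLabels U.reading i =
        (U.standardOrder.filter fun c => c.1 = i).map fun c => U.entry c.1 c.2 := by
      simp [rowLabels, reading, List.filter_map, Function.comp_def]
    rw [h, hU.filter_standardOrder, List.map_map]
    refine List.ext_getElem (by simp) fun k hk hk' => ?_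
    simp [entry, List.getElem?_eq_getElem hk]
  sorted := by
    rw [reading, List.pairwise_map]
    refine U.pairwise_standardOrder.imp_of_mem ?_
    rintro ⟨a, b⟩ ⟨c, d⟩ h h' h1
    rw [mem_standardOrder] at h h'
    simp only [StdLE] at h h' h1 ⊢
    rcases h1 with h1 | ⟨h1, hbd⟩
    · exact Or.inl h1
    refine Or.inr ⟨h1, ?_⟩
    by_contra! hac
    -- If the later box `(c, d)` were in a lower row, the box above it in row `a` would have a
    -- smaller label, yet lie weakly right of `(a, b)`, which carries the same label as `(c, d)`.
    have hbox : U.HasBox a d := ⟨h.1.trans hbd, h'.2.trans_le (hU.outer_antitone hac.le)⟩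
    have h2 := hU.col_strict _ _ _ hac hbox h'
    rcases hbd.eq_or_lt with rfl | hbd
    · omega
    · have := hU.row_weak _ _ _ hbd h hbox
      omega
  lattice := by
    simpa [reading, Function.comp_def] using hU.isLattice_standardOrder
  pos p hp := by
    obtain ⟨c, hc, rfl⟩ := List.mem_map.1 hp
    exact hU.entry_pos _ _ (mem_standardOrder.1 hc)
  row_pos r hr := by
    obtain ⟨i, hi, rfl⟩ := List.mem_iff_getElem.1 hr
    rw [← outer_eq_getElem hi]
    exact hU.row_ne_empty i hi

theorem IsReading.eq_reading {U : SkewFilling} {t : List (ℕ × ℕ)} (h : U.IsReading t) :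
    t = U.reading :=
  eq_of_rowLabels_eq h.sorted h.isSSYT.isReading.sorted fun i => by
    rw [← h.labels_eq, ← h.isSSYT.isReading.labels_eq]

theorem isInternalInsertionOrderWord_iff {T : SkewFilling} {u : List ℕ} :
    T.IsInternalInsertionOrderWord u ↔ IsLattice T.inner u.reverse := by
  constructor
  · rintro ⟨U, hU, hTU, rfl⟩
    rw [companionWord_eq, List.reverse_reverse, funext hTU]
    exact hU.isReading.lattice
  · intro h
    -- Conversely, label the boxes by their position in the reversed word; numbering from 1 keeps
    -- the labels positive.
    have hsnd : ((u.reverse.zipIdx 1).map Prod.swap).map Prod.snd = u.reverse := by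
      rw [List.map_map]
      exact List.zipIdx_map_fst 1 u.reverse
    have hfst : ((u.reverse.zipIdx 1).map Prod.swap).map Prod.fst =
        List.range' 1 u.reverse.length := by
      rw [List.map_map]
      exact List.zipIdx_map_snd 1 u.reverse
    obtain ⟨U, hTU, hU⟩ := exists_isReading (T := T) (t := (u.reverse.zipIdx 1).map Prod.swap)
      (by
        have : (((u.reverse.zipIdx 1).map Prod.swap).map Prod.fst).Pairwise (· < ·) := by
          rw [hfst]; exact List.pairwise_lt_range'
        exact (List.pairwise_map.1 this).imp Or.inl)
      (hsnd.symm ▸ h)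
      (fun p hp => by
        have := List.mem_map_of_mem (f := Prod.fst) hp
        rw [hfst, List.mem_range'_1] at this
        omega)
    refine ⟨U, hU.isSSYT, hTU, ?_⟩
    rw [companionWord_eq, ← hU.eq_reading, hsnd, List.reverse_reverse]

end SkewFilling

/-! ### Bumping is scanning -/

theorem rowLabels_scan_of_lt {t : List (ℕ × ℕ)} {c i : ℕ} (h : i < c) :
    rowLabels (scan c t) i = rowLabels t i := by
  induction t generalizing c with
  | nil => rfl
  | cons p t ih =>
    obtain ⟨v, r⟩ := p
    simp only [scan]
    split_ifs with hr
    · rw [rowLabels_cons, rowLabels_cons, if_neg (by omega), if_neg (by omega), ih (by omega)]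
    · rw [rowLabels_cons, rowLabels_cons, ih h]

theorem scan_append_cons {t t' : List (ℕ × ℕ)} {c v : ℕ} (h : rowLabels t c = []) :
    scan c (t ++ (v, c) :: t') = t ++ (v, c + 1) :: scan (c + 1) t' := by
  rw [scan_append_of_rowLabels_eq_nil h, scan, if_pos rfl]

namespace SkewFilling

theorem rowInsert_of_le {x : ℕ} {l : List ℕ} (h : ∀ y ∈ l, y ≤ x) :
    rowInsert x l = (l ++ [x], none) := by
  induction l with
  | nil => rfl
  | cons y l ih =>
    rw [List.forall_mem_cons] at h
    rw [rowInsert, if_neg (by omega), ih h.2]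
    rfl

theorem rowInsert_append_cons {x y : ℕ} {l l' : List ℕ} (h : ∀ z ∈ l, z ≤ x) (hxy : x < y) :
    rowInsert x (l ++ y :: l') = (l ++ x :: l', some y) := by
  induction l with
  | nil => simp [rowInsert, hxy]
  | cons z l ih =>
    rw [List.forall_mem_cons] at h
    rw [List.cons_append, rowInsert, if_neg (by omega), ih h.2]
    rfl

theorem labels_cons_zero (m : ℕ) (l : List ℕ) (T : SkewFilling) :
    labels ((m, l) :: T) 0 = l := rfl

theorem labels_cons_succ (r : ℕ × List ℕ) (T : SkewFilling) (j : ℕ) :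
    labels (r :: T) (j + 1) = labels T j := rfl

theorem inner_cons_succ (r : ℕ × List ℕ) (T : SkewFilling) (j : ℕ) :
    inner (r :: T) (j + 1) = inner T j := rfl

/-- Here `a` and `b` are the boxes before and after the inserted one in the standard order. By `ha`
and `hbx`, `x` bumps the first box of `b` in row `k`, which is the next box moved by `scan`;
splitting `b` there restores the hypotheses one row further down. The offset `k` keeps track of the
rows already passed. -/
theorem labels_insertRows {T : SkewFilling} {k x : ℕ} {a b : List (ℕ × ℕ)}
    (hT : ∀ j, labels T j = rowLabels (a ++ b) (k + j)) (hb : b.Pairwise StdLE)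
    (ha : ∀ p ∈ a, p.1 ≤ x) (hbx : ∀ v, (v, k) ∈ b → x < v) (j : ℕ) :
    labels (insertRows x T) j = rowLabels (a ++ (x, k) :: scan k b) (k + j) := by
  induction T generalizing k x a b j with
  | nil =>
    have h0 : ∀ j, rowLabels a (k + j) = [] ∧ rowLabels b (k + j) = [] := fun j => by
      have := hT j
      rw [rowLabels_append] at this
      exact List.append_eq_nil_iff.1 this.symm
    rw [scan_of_rowLabels_eq_nil (by simpa using (h0 0).2), rowLabels_append, rowLabels_cons, (h0 j).1, (h0 j).2,
      insertRows]
    cases j with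
    | zero => simp [labels]
    | succ j => rw [if_neg (by omega)]; rfl
  | cons r T ih =>
    obtain ⟨m, l⟩ := r
    have hl : l = rowLabels a k ++ rowLabels b k := by
      rw [← rowLabels_append]; exact hT 0
    have hT' : ∀ j, labels T j = rowLabels (a ++ b) (k + 1 + j) := fun j => by
      rw [add_right_comm]; exact hT (j + 1)
    have hal : ∀ v ∈ rowLabels a k, v ≤ x := fun v hv => ha _ (mem_rowLabels.1 hv)
    rw [insertRows]
    rcases hbl : rowLabels b k with - | ⟨y, l'⟩
    · rw [hl, hbl, List.append_nil, rowInsert_of_le hal, scan_of_rowLabels_eq_nil hbl]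
      cases j with
      | zero =>
        rw [labels_cons_zero, rowLabels_append, rowLabels_cons, add_zero, if_pos rfl, hbl]
      | succ j =>
        rw [labels_cons_succ, hT', rowLabels_append, rowLabels_append, rowLabels_cons,
          if_neg (by omega), add_right_comm, add_assoc]
    · obtain ⟨b₁, b₂, rfl, hb₁, hb₂⟩ := eq_append_of_rowLabels_eq (a := []) hbl
      have hxy : x < y := hbx y (by simp)
      have hs := List.pairwise_append.1 hb
      have hs' := List.pairwise_cons.1 hs.2.1
      rw [hl, hbl, rowInsert_append_cons hal hxy, scan_append_cons hb₁]
      cases j with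
      | zero =>
        rw [labels_cons_zero, rowLabels_append, rowLabels_cons, add_zero, if_pos rfl,
          rowLabels_append, hb₁, rowLabels_cons, if_neg (by omega),
          rowLabels_scan_of_lt (by omega), hb₂, List.nil_append]
      | succ j =>
        rw [labels_cons_succ, ih (k := k + 1) (x := y) (a := a ++ b₁) (b := b₂)
          (fun j => ?_) hs'.2 ?_ ?_ j]
        · simp only [rowLabels_append, rowLabels_cons]
          rw [if_neg (by omega : ¬ k = k + (j + 1)), add_right_comm k 1 j, add_assoc k j 1,
            List.append_assoc]
        · intro p hp
          rcases List.mem_append.1 hp with hp | hp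
          · exact (ha p hp).trans hxy.le
          · have := hs.2.2 p hp _ List.mem_cons_self
            simp only [StdLE] at this
            omega
        · intro v hv
          have := hs'.1 _ hv
          simp only [StdLE] at this
          omega
        · rw [hT']
          simp only [rowLabels_append, rowLabels_cons]
          rw [if_neg (by omega), List.append_assoc]

theorem inner_insertRows (x : ℕ) (T : SkewFilling) (j : ℕ) :
    inner (insertRows x T) j = inner T j := by
  induction T generalizing x j with
  | nil => cases j <;> rfl
  | cons r T ih =>
    obtain ⟨m, l⟩ := r
    rw [insertRows]
    rcases rowInsert x l with ⟨l', - | y⟩ <;> cases j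
    · rfl
    · rfl
    · rfl
    · exact ih _ _

theorem length_rowInsert_pos (x : ℕ) (l : List ℕ) : 0 < (rowInsert x l).1.length := by
  cases l with
  | nil => simp [rowInsert]
  | cons y l => rw [rowInsert]; split_ifs <;> simp

theorem row_pos_insertRows {x : ℕ} {T : SkewFilling} (h : ∀ r ∈ T, 0 < r.1 + r.2.length) :
    ∀ r ∈ insertRows x T, 0 < r.1 + r.2.length := by
  induction T generalizing x with
  | nil => simp [insertRows]
  | cons r T ih =>
    obtain ⟨m, l⟩ := r
    have hl := length_rowInsert_pos x l
    rw [List.forall_mem_cons] at h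
    rw [insertRows]
    rcases hr : rowInsert x l with ⟨l', - | y⟩ <;> rw [hr] at hl
    · exact List.forall_mem_cons.2 ⟨Nat.add_pos_right _ hl, h.2⟩
    · exact List.forall_mem_cons.2 ⟨Nat.add_pos_right _ hl, ih h.2⟩

theorem labels_vacate {T : SkewFilling} {k i : ℕ} {t : List (ℕ × ℕ)}
    (hT : ∀ j, labels T j = rowLabels t (k + j)) (ht : t.Pairwise StdLE) (hi : i ≤ T.length)
    (j : ℕ) : labels (vacate i T) j = rowLabels (scan (k + i) t) (k + j) := by
  induction i generalizing T k j with
  | zero =>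
    rcases T with - | ⟨⟨m, - | ⟨x, l⟩⟩, T⟩
    · rw [scan_of_rowLabels_eq_nil (hT 0).symm, ← hT, vacate]
      cases j <;> rfl
    · rw [scan_of_rowLabels_eq_nil (hT 0).symm, ← hT, vacate]
      cases j <;> rfl
    · obtain ⟨t₁, t₂, rfl, h₁, h₂⟩ := eq_append_of_rowLabels_eq (a := []) (hT 0).symm
      rw [add_zero] at h₁ h₂ ht hT ⊢
      have hs := List.pairwise_append.1 ht
      have hs' := List.pairwise_cons.1 hs.2.1
      rw [scan_append_cons h₁, vacate]
      cases j with
      | zero =>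
        rw [labels_cons_zero, rowLabels_append, rowLabels_cons, add_zero, if_neg (by omega),
          rowLabels_scan_of_lt (by omega), h₁, h₂, List.nil_append]
      | succ j =>
        rw [labels_cons_succ, labels_insertRows (k := k + 1) (a := t₁) (b := t₂)
          (fun j => ?_) hs'.2 ?_ ?_ j, add_right_comm, add_assoc]
        · intro p hp
          have := hs.2.2 p hp _ List.mem_cons_self
          simp only [StdLE] at this
          omega
        · intro v hv
          have := hs'.1 _ hv
          simp only [StdLE] at this
          omega
        · have := hT (j + 1)
          rw [labels_cons_succ] at this
          rw [this, rowLabels_append, rowLabels_append, rowLabels_cons, if_neg (by omega),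
            add_right_comm, add_assoc]
  | succ i ih =>
    rcases T with - | ⟨r, T⟩
    · simp at hi
    · rw [vacate]
      cases j with
      | zero => rw [rowLabels_scan_of_lt (by omega)]; exact hT 0
      | succ j =>
        rw [labels_cons_succ, ih (k := k + 1) (fun j => ?_) (by simpa using hi) j,
          add_right_comm k 1 j, add_right_comm k 1 i]
        · rfl
        · rw [add_right_comm]; exact hT (j + 1)

theorem inner_vacate {T : SkewFilling} {i : ℕ} (hi : i ≤ T.length) :
    inner (vacate i T) = addBox (inner T) i := by
  funext j
  induction i generalizing T j with
  | zero =>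
    rcases T with - | ⟨⟨m, - | ⟨x, l⟩⟩, T⟩ <;> cases j
    · rfl
    · rfl
    · rfl
    · rfl
    · rfl
    · exact inner_insertRows _ _ _
  | succ i ih =>
    rcases T with - | ⟨r, T⟩
    · simp at hi
    · cases j with
      | zero => simp [vacate, addBox, inner]
      | succ j =>
        rw [vacate, inner_cons_succ, ih (by simpa using hi)]
        simp [addBox, inner_cons_succ]

theorem row_pos_vacate {T : SkewFilling} {i : ℕ} (h : ∀ r ∈ T, 0 < r.1 + r.2.length) :
    ∀ r ∈ vacate i T, 0 < r.1 + r.2.length := by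
  induction i generalizing T with
  | zero =>
    rcases T with - | ⟨⟨m, - | ⟨x, l⟩⟩, T⟩
    · simp [vacate]
    · rw [List.forall_mem_cons] at h
      exact List.forall_mem_cons.2 ⟨by simp, h.2⟩
    · rw [List.forall_mem_cons] at h
      exact List.forall_mem_cons.2 ⟨by simp only; omega, row_pos_insertRows h.2⟩
  | succ i ih =>
    rcases T with - | ⟨r, T⟩
    · simp [vacate]
    · rw [List.forall_mem_cons] at h
      exact List.forall_mem_cons.2 ⟨h.1, ih h.2⟩

/-- Below this bound `vacate` never runs out of rows, a case in which it would add no blank cell. -/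
theorem IsInnerCorner.le_length {T : SkewFilling} {i j : ℕ} (h : T.IsInnerCorner i j) :
    i ≤ T.length := by
  rcases h.2 with rfl | h
  · exact Nat.zero_le _
  · by_contra! h'
    rw [inner_of_length_le (T := T) (i := i - 1) (by omega)] at h
    omega

/-! ### Composites of internal insertions -/

theorem inner_of_internalInsert_eq_some {T P : SkewFilling} {c : ℕ × ℕ}
    (h : T.internalInsert c = some P) : P.inner = addBox T.inner c.1 := by
  unfold internalInsert at h
  split_ifs at h with hc
  obtain rfl := Option.some.inj h
  exact inner_vacate hc.le_length

theorem IsReading.exists_phi {T : SkewFilling} {t : List (ℕ × ℕ)} (h : T.IsReading t) {i : ℕ}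
    (hi : Antitone (addBox T.inner i)) :
    ∃ P, phi i T = some P ∧ P.IsReading (scan i t) ∧ P.inner = addBox T.inner i := by
  have hc : T.IsInnerCorner i (T.inner i) := ⟨rfl, (antitone_addBox h.lattice.antitone).1 hi⟩
  have hP := inner_vacate hc.le_length
  refine ⟨vacate i T, if_pos hc, ⟨fun j => ?_, pairwise_scan h.sorted i, ?_, fun p hp => ?_,
    row_pos_vacate h.row_pos⟩, hP⟩
  · simpa using labels_vacate (k := 0) (by simpa using h.labels_eq) h.sorted hc.le_length j
  · rw [hP]
    exact isLattice_scan h.lattice hi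
  · have hm := List.mem_map_of_mem (f := Prod.fst) hp
    rw [map_fst_scan] at hm
    obtain ⟨q, hq, hqp⟩ := List.mem_map.1 hm
    rw [← hqp]
    exact h.pos q hq

theorem IsReading.exists_phiWord {T : SkewFilling} {t : List (ℕ × ℕ)} (h : T.IsReading t)
    {u : List ℕ} (hu : IsLattice T.inner u.reverse) :
    ∃ P, phiWord u T = some P ∧ P.IsReading (scanWord u t) ∧
      P.inner = u.reverse.foldl addBox T.inner := by
  induction u with
  | nil => exact ⟨T, rfl, h, rfl⟩
  | cons a u ih =>
    rw [List.reverse_cons, isLattice_append] at hu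
    obtain ⟨P, h1, h2, h3⟩ := ih hu.1
    rw [← h3] at hu
    obtain ⟨Q, h4, h5, h6⟩ := h2.exists_phi hu.2.2
    refine ⟨Q, by rw [phiWord, h1, Option.bind_some, h4], h5, ?_⟩
    rw [h6, h3, List.reverse_cons, List.foldl_append]
    rfl

theorem phiWord_append (u v : List ℕ) (T : SkewFilling) :
    phiWord (u ++ v) T = (phiWord v T).bind (phiWord u) := by
  induction u with
  | nil => simp [phiWord]
  | cons a u ih =>
    rw [List.cons_append, phiWord, ih, Option.bind_assoc]
    rfl

/-- The hypothesis places each cell at the end of its row of the current inner border, which every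
successful insertion lengthens by one cell; if one insertion fails, both sides are `none`. -/
theorem foldlM_internalInsert {T : SkewFilling} {L : List (ℕ × ℕ)}
    (h : ∀ a c b, L = a ++ c :: b → c.2 = T.inner c.1 + (a.map Prod.fst).count c.1) :
    L.foldlM internalInsert T = phiWord (L.map Prod.fst).reverse T := by
  induction L generalizing T with
  | nil => rfl
  | cons c L ih =>
    obtain ⟨i, j⟩ := c
    have hj : j = T.inner i := by simpa using h [] _ _ rfl
    subst hj
    rw [List.foldlM_cons, List.map_cons, List.reverse_cons, phiWord_append]
    change _ = (T.internalInsert (i, T.inner i)).bind _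
    rcases hP : T.internalInsert (i, T.inner i) with - | P
    · rfl
    · refine ih fun a c b hab => ?_
      have := h ((i, T.inner i) :: a) c b (by rw [hab]; rfl)
      rw [this, inner_of_internalInsert_eq_some hP, addBox, List.map_cons, List.count_cons]
      simp only [beq_iff_eq, eq_comm (a := c.1)]
      omega

theorem skewRSKP_eq_phiWord {T U : SkewFilling} (hU : U.IsSSYT) (h : T.SameInner U) :
    skewRSKP T U = phiWord U.companionWord T :=
  foldlM_internalInsert fun a c b hab => by rw [h, hU.col_eq hab]

/-- Knuth equivalent words act in the same way on a tableau, as soon as one of them is an internal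
insertion order word. -/
theorem IsSSYT.phiWord_eq_of_knuthEquiv {T : SkewFilling} (hT : T.IsSSYT) {u v : List ℕ}
    (hu : IsLattice T.inner u.reverse) (h : KnuthEquiv v u) :
    ∃ P : SkewFilling, P.IsSSYT ∧ phiWord u T = some P ∧ phiWord v T = some P := by
  obtain ⟨hlat, hscan, hperm⟩ := h.invariants
  obtain ⟨P, h1, h2, h3⟩ := hT.isReading.exists_phiWord hu
  obtain ⟨Q, h4, h5, h6⟩ := hT.isReading.exists_phiWord ((hlat _).2 hu)
  refine ⟨P, h2.isSSYT, h1, ?_⟩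
  -- Borders agree by content, labels by equality of the scans.
  rw [h4, ext_of_row_pos h5.row_pos h2.row_pos (fun i => ?_) fun i => ?_]
  · rw [h3, h6, foldl_addBox, foldl_addBox, List.count_reverse, List.count_reverse,
      hperm.count_eq]
  · rw [h5.labels_eq, h2.labels_eq, hscan]

end SkewFilling

theorem theorem4p3 (T : SkewFilling) (hT : T.IsSSYT) :
    (∀ u v : List ℕ, T.IsInternalInsertionOrderWord u → KnuthEquiv v u →
      T.IsInternalInsertionOrderWord v ∧
      ∃ P : SkewFilling, P.IsSSYT ∧
        SkewFilling.phiWord u T = some P ∧ SkewFilling.phiWord v T = some P) ∧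
    (∀ U V : SkewFilling, U.IsSSYT → V.IsSSYT → T.SameInner U → T.SameInner V →
      KnuthEquiv U.companionWord V.companionWord →
      ∃ P : SkewFilling, P.IsSSYT ∧
        SkewFilling.skewRSKP T U = some P ∧ SkewFilling.skewRSKP T V = some P) := by
  refine ⟨fun u v hu h => ?_, fun U V hU hV hTU hTV h => ?_⟩
  · rw [SkewFilling.isInternalInsertionOrderWord_iff] at hu ⊢
    exact ⟨(h.invariants.1 _).2 hu, hT.phiWord_eq_of_knuthEquiv hu h⟩
  · rw [SkewFilling.skewRSKP_eq_phiWord hU hTU, SkewFilling.skewRSKP_eq_phiWord hV hTV]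
    have hV' : T.IsInternalInsertionOrderWord V.companionWord := ⟨V, hV, hTV, rfl⟩
    rw [SkewFilling.isInternalInsertionOrderWord_iff] at hV'
    obtain ⟨P, hP, h1, h2⟩ := hT.phiWord_eq_of_knuthEquiv hV' h
    exact ⟨P, hP, h2, h1⟩
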